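/- Proposition 2.4. All manifolds are smooth, real and finite dimensional. Let $H$ be a Lie group with Lie algebra $\mathfrak h$, and let $G\subset H$ be a (possibly only immersed) Lie subgroup with Lie algebra $\mathfrak g\subset\mathfrak h$. Let $\mathfrak h=V\oplus\mathfrak g$ be a reductive decomposition, i.e. a direct sum of vector spaces with $[\mathfrak g,V]\subset V$ and $\mathrm{Ad}(G)V\subset V$, and assume that the adjoint representation $\mathrm{Ad}:G\to GL(V)$ is faithful. Let $p:P\to M$ be a principal $G$-bundle with principal right action $r^g(u)=r_u(g)=u.g$, fundamental vector fields $\zeta_X(u)=T_e(r_u)X$ for $X\in\mathfrak g$, and vertical bundle $VP=\ker Tp$. We use the following notions. * A principal Cartan connection on $p:P\to M$ is a smooth 1-form $\kappa:TP\to\mathfrak h$ such that (a) $\kappa_u:T_uP\to\mathfrak h$ is a linear isomorphism for every $u\in P$; (b) the vector fields $\zeta^\kappa_X(u)=\kappa_u^{-1}(X)$ satisfy $[\zeta^\kappa_X,\zeta^\kappa_Y]=\zeta^\kappa_{[X,Y]}$ for all $X\in\mathfrak h$, $Y\in\mathfrak g$; (c) $\kappa(\zeta_X(u))=X$ for all $X\in\mathfrak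 g$, $u\in P$; (d) $\kappa\circ T(r^g)=\mathrm{Ad}(g^{-1})\circ\kappa$ for all $g\in G$. * A principal connection form on $P$ is a smooth 1-form $\omega:TP\to\mathfrak g$ with $\omega(\zeta_X(u))=X$ for all $X\in\mathfrak g$, $u\in P$, and $\omega\circ T(r^g)=\mathrm{Ad}(g^{-1})\circ\omega$ for all $g\in G$. * A displacement form is a smooth 1-form $\theta:TP\to V$ with $\theta\circ T(r^g)=\mathrm{Ad}(g^{-1})|_V\circ\theta$ for all $g\in G$ and $\ker\theta=VP$. The pair $(p:P\to M,\theta)$ is a $G$-structure (for $G$ regarded as a linear Lie group through its smooth faithful representation in $V$) if $\theta$ is a displacement form and $\dim M=\dim V$. Then: 1. If $\kappa:TP\to\mathfrak h=V\oplus\mathfrak g$ is a principal Cartan connection on $p:P\to M$, with components $\theta=\mathrm{pr}_V\circ\kappa$ and $\omega=\mathrm{pr}_{\mathfrak g}\circ\kappa$, then $\theta$ is a displacement form and $\omega$ is a principal connection form, and $(p:P\to M,\theta)$ is a $G$-structure (in particular $\dim M=\dim V$) with connection form $\omega$. 2. Conversely, if $(p:P\to M,\theta)$ is a $G$-structure and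 $\omega$ is a principal connection form on $P$, then $\kappa=\theta+\omega$ is a principal Cartan connection on $p:P\to M$. -/

import Mathlib

open scoped Manifold ContDiff

noncomputable section

namespace CartanConn

/-! Manifolds are smooth, real, finite dimensional and without boundary: they are charted on a
finite dimensional normed space `E` through the model `𝓘(ℝ, E)`.  A tangent space `T_x M` is a copy
of `E` that is determined by the point `x`; below, tangent spaces at provably equal points (such as
`g * 1 * g⁻¹` and `1`) are identified by a type ascription. -/

section LieGroups

variable {EG : Type*} [NormedAddCommGroup EG] [NormedSpace ℝ EG]
  {G : Type*} [TopologicalSpace G] [ChartedSpace EG G] [Group G]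
  {EH : Type*} [NormedAddCommGroup EH] [NormedSpace ℝ EH]
  {H : Type*} [TopologicalSpace H] [ChartedSpace EH H] [Group H]

/-- The Lie algebra `T_1 G` of `G`, with the bracket of left invariant vector fields. -/
abbrev Lie (EG : Type*) [NormedAddCommGroup EG] [NormedSpace ℝ EG]
    (G : Type*) [TopologicalSpace G] [ChartedSpace EG G] [Group G] : Type _ :=
  GroupLieAlgebra 𝓘(ℝ, EG) G

/-- The adjoint action `Ad g = T_1 (x ↦ g x g⁻¹)` of `G` on its Lie algebra. -/
def Ad (g : G) : Lie EG G →ₗ[ℝ] Lie EG G :=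
  (mfderiv 𝓘(ℝ, EG) 𝓘(ℝ, EG) (fun x : G => g * x * g⁻¹) 1).toLinearMap

theorem Ad_one_apply (v : Lie EG G) : Ad (1 : G) v = v := by
  have key : ∀ f : G → G, f = id → mfderiv 𝓘(ℝ, EG) 𝓘(ℝ, EG) f 1 v = (v : EG) := by
    rintro f rfl
    rw [mfderiv_id]
    rfl
  exact key _ (by ext x; simp)

theorem Ad_mul_apply [LieGroup 𝓘(ℝ, EG) ∞ G] (g k : G) (v : Lie EG G) :
    Ad (g * k) v = Ad g (Ad k v) := by
  have hd : ∀ (a x : G), MDifferentiableAt 𝓘(ℝ, EG) 𝓘(ℝ, EG) (fun x : G => a * x * a⁻¹) x := by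
    intro a x
    have : ContMDiff 𝓘(ℝ, EG) 𝓘(ℝ, EG) ∞ (fun x : G => a * x * a⁻¹) :=
      (contMDiff_const.mul contMDiff_id).mul contMDiff_const
    exact this.contMDiffAt.mdifferentiableAt (by simp)
  have key : ∀ (f : G → G) (y : G), f = (fun x : G => g * x * g⁻¹) ∘ (fun x : G => k * x * k⁻¹) →
      y = k * 1 * k⁻¹ → mfderiv 𝓘(ℝ, EG) 𝓘(ℝ, EG) f 1 v
        = (mfderiv 𝓘(ℝ, EG) 𝓘(ℝ, EG) (fun x : G => g * x * g⁻¹) y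
          (mfderiv 𝓘(ℝ, EG) 𝓘(ℝ, EG) (fun x : G => k * x * k⁻¹) 1 v : EG) : EG) := by
    rintro f y rfl rfl
    rw [mfderiv_comp (1 : G) (hd g _) (hd k _)]
    rfl
  exact key _ 1 (by ext x; simp [mul_assoc]) (by simp)

/-- The differential at the identity of a homomorphism of Lie groups. -/
def dHom (EG : Type*) [NormedAddCommGroup EG] [NormedSpace ℝ EG]
    {G : Type*} [TopologicalSpace G] [ChartedSpace EG G] [Group G]
    (EH : Type*) [NormedAddCommGroup EH] [NormedSpace ℝ EH]
    {H : Type*} [TopologicalSpace H] [ChartedSpace EH H] [Group H]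
    (ι : G →* H) : Lie EG G →ₗ[ℝ] Lie EH H :=
  (mfderiv 𝓘(ℝ, EG) 𝓘(ℝ, EH) ι 1).toLinearMap

/-- `ι` exhibits `G` as an (immersed) Lie subgroup of `H`. -/
structure IsLieSubgroup (EG : Type*) [NormedAddCommGroup EG] [NormedSpace ℝ EG]
    {G : Type*} [TopologicalSpace G] [ChartedSpace EG G] [Group G]
    (EH : Type*) [NormedAddCommGroup EH] [NormedSpace ℝ EH]
    {H : Type*} [TopologicalSpace H] [ChartedSpace EH H] [Group H]
    (ι : G →* H) : Prop where
  contMDiff : ContMDiff 𝓘(ℝ, EG) 𝓘(ℝ, EH) ∞ ι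
  injective : Function.Injective ι
  injective_dHom : Function.Injective (dHom EG EH ι)

/-- `𝔤`, as a subspace of `𝔥`. -/
def subAlg (EG : Type*) [NormedAddCommGroup EG] [NormedSpace ℝ EG]
    {G : Type*} [TopologicalSpace G] [ChartedSpace EG G] [Group G]
    (EH : Type*) [NormedAddCommGroup EH] [NormedSpace ℝ EH]
    {H : Type*} [TopologicalSpace H] [ChartedSpace EH H] [Group H]
    (ι : G →* H) : Submodule ℝ (Lie EH H) :=
  LinearMap.range (dHom EG EH ι)

/-- The reductive decomposition `𝔥 = V ⊕ 𝔤`, `[𝔤, V] ⊆ V`, with `V` stable under `Ad G`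
(so that there is an adjoint representation of `G` in `V`; for connected `G` this follows). -/
structure IsReductive (EG : Type*) [NormedAddCommGroup EG] [NormedSpace ℝ EG]
    {G : Type*} [TopologicalSpace G] [ChartedSpace EG G] [Group G]
    {EH : Type*} [NormedAddCommGroup EH] [NormedSpace ℝ EH]
    {H : Type*} [TopologicalSpace H] [ChartedSpace EH H] [Group H]
    (ι : G →* H) (V : Submodule ℝ (Lie EH H)) : Prop where
  isCompl : IsCompl V (subAlg EG EH ι)
  lie_mem : ∀ X ∈ subAlg EG EH ι, ∀ v ∈ V, ⁅X, v⁆ ∈ V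
  Ad_mem : ∀ g : G, ∀ v ∈ V, Ad (ι g) v ∈ V

/-- The adjoint representation of `G` in `V`. -/
def adRep [LieGroup 𝓘(ℝ, EH) ∞ H] {ι : G →* H} {V : Submodule ℝ (Lie EH H)}
    (hV : IsReductive EG ι V) : Representation ℝ G V where
  toFun g := (Ad (ι g)).restrict (hV.Ad_mem g)
  map_one' := by
    ext v
    simp [LinearMap.restrict_apply, Ad_one_apply]
  map_mul' g k := by
    ext v
    simp [LinearMap.restrict_apply, Ad_mul_apply]

/-- The projection `𝔥 = V ⊕ 𝔤 → V`. -/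
def prV {ι : G →* H} {V : Submodule ℝ (Lie EH H)} (hV : IsReductive EG ι V) :
    Lie EH H →ₗ[ℝ] V :=
  V.projectionOnto (subAlg EG EH ι) hV.isCompl

/-- The projection `𝔥 = V ⊕ 𝔤 → 𝔤`, with values in the Lie algebra of `G`. -/
def prG {ι : G →* H} {V : Submodule ℝ (Lie EH H)} (hι : IsLieSubgroup EG EH ι)
    (hV : IsReductive EG ι V) : Lie EH H →ₗ[ℝ] Lie EG G :=
  (LinearEquiv.ofInjective (dHom EG EH ι) hι.injective_dHom).symm.toLinearMap ∘ₗ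
    (subAlg EG EH ι).projectionOnto V hV.isCompl.symm

end LieGroups

section Forms

variable {EP : Type*} [NormedAddCommGroup EP] [NormedSpace ℝ EP]
  {P : Type*} [TopologicalSpace P] [ChartedSpace EP P]

/-- A (not necessarily smooth) `W`-valued 1-form on `P`. -/
abbrev Form (EP : Type*) [NormedAddCommGroup EP] [NormedSpace ℝ EP]
    (P : Type*) [TopologicalSpace P] [ChartedSpace EP P]
    (W : Type*) [AddCommGroup W] [Module ℝ W] : Type _ :=
  ∀ u : P, TangentSpace 𝓘(ℝ, EP) u →ₗ[ℝ] W

/-- Smoothness of a 1-form with values in a finite dimensional vector space `W`: all its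
components, as functions on the tangent bundle `TP`, are smooth. -/
def IsSmoothForm [IsManifold 𝓘(ℝ, EP) ∞ P] {W : Type*} [AddCommGroup W] [Module ℝ W]
    (α : Form EP P W) : Prop :=
  ∀ ℓ : Module.Dual ℝ W, ContMDiff 𝓘(ℝ, EP).tangent 𝓘(ℝ) ∞
    (fun ξ : TangentBundle 𝓘(ℝ, EP) P => ℓ (α ξ.proj ξ.snd))

/-- The parallel vector field `ζ_X(u) = (κ_u)⁻¹ X` of a non-degenerate form `κ`. -/
def parallelField {W : Type*} [AddCommGroup W] [Module ℝ W] (κ : Form EP P W)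
    (hκ : ∀ u, Function.Bijective (κ u)) (X : W) (u : P) : TangentSpace 𝓘(ℝ, EP) u :=
  (LinearEquiv.ofBijective (κ u) (hκ u)).symm X

/-- A Cartan connection of type `𝔥/𝔤` on the manifold `P`, for the Lie algebra `𝔥` of `H`. -/
structure IsCartanConnection [IsManifold 𝓘(ℝ, EP) ∞ P]
    {EH : Type*} [NormedAddCommGroup EH] [NormedSpace ℝ EH]
    {H : Type*} [TopologicalSpace H] [ChartedSpace EH H] [Group H]
    (𝔤 : Submodule ℝ (Lie EH H)) (κ : Form EP P (Lie EH H)) : Prop where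
  smooth : IsSmoothForm κ
  bijective : ∀ u, Function.Bijective (κ u)
  bracket : ∀ X : Lie EH H, ∀ Y ∈ 𝔤, ∀ u : P,
    VectorField.mlieBracket 𝓘(ℝ, EP) (parallelField κ bijective X) (parallelField κ bijective Y) u
      = parallelField κ bijective ⁅X, Y⁆ u

end Forms

section Bundles

variable {EG : Type*} [NormedAddCommGroup EG] [NormedSpace ℝ EG]
  {G : Type*} [TopologicalSpace G] [ChartedSpace EG G] [Group G]
  {EP : Type*} [NormedAddCommGroup EP] [NormedSpace ℝ EP]
  {P : Type*} [TopologicalSpace P] [ChartedSpace EP P] [MulAction Gᵐᵒᵖ P]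
  {EM : Type*} [NormedAddCommGroup EM] [NormedSpace ℝ EM]
  {M : Type*} [TopologicalSpace M] [ChartedSpace EM M]

/-- The principal right action `r^g : u ↦ u.g`; a right action of `G` is an action of `Gᵐᵒᵖ`. -/
def rt (g : G) (u : P) : P := MulOpposite.op g • u

/-- `p : P → M` with the right action of `G` on `P` is a smooth principal `G`-bundle: it is locally
isomorphic, `G`-equivariantly and over the base, to `U × G → U`. -/
structure IsPrincipalBundle (EG : Type*) [NormedAddCommGroup EG] [NormedSpace ℝ EG]
    (G : Type*) [TopologicalSpace G] [ChartedSpace EG G] [Group G]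
    (EP : Type*) [NormedAddCommGroup EP] [NormedSpace ℝ EP]
    {P : Type*} [TopologicalSpace P] [ChartedSpace EP P] [MulAction Gᵐᵒᵖ P]
    (EM : Type*) [NormedAddCommGroup EM] [NormedSpace ℝ EM]
    {M : Type*} [TopologicalSpace M] [ChartedSpace EM M]
    (p : P → M) : Prop where
  contMDiff_action : ContMDiff (𝓘(ℝ, EP).prod 𝓘(ℝ, EG)) 𝓘(ℝ, EP) ∞
    (fun q : P × G => rt q.2 q.1)
  contMDiff_proj : ContMDiff 𝓘(ℝ, EP) 𝓘(ℝ, EM) ∞ p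
  proj_rt : ∀ (u : P) (g : G), p (rt g u) = p u
  exists_trivialization : ∀ x : M, ∃ e : Bundle.Trivialization G p, x ∈ e.baseSet ∧
    ContMDiffOn 𝓘(ℝ, EP) (𝓘(ℝ, EM).prod 𝓘(ℝ, EG)) ∞ e e.source ∧
    ContMDiffOn (𝓘(ℝ, EM).prod 𝓘(ℝ, EG)) 𝓘(ℝ, EP) ∞ e.toOpenPartialHomeomorph.symm e.target ∧
    ∀ u ∈ e.source, ∀ g : G, e (rt g u) = ((e u).1, (e u).2 * g)

/-- The vertical space `V_u P = ker T_u p`. -/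
def vertical (EP : Type*) [NormedAddCommGroup EP] [NormedSpace ℝ EP]
    {P : Type*} [TopologicalSpace P] [ChartedSpace EP P]
    (EM : Type*) [NormedAddCommGroup EM] [NormedSpace ℝ EM]
    {M : Type*} [TopologicalSpace M] [ChartedSpace EM M]
    (p : P → M) (u : P) : Submodule ℝ (TangentSpace 𝓘(ℝ, EP) u) :=
  LinearMap.ker (mfderiv 𝓘(ℝ, EP) 𝓘(ℝ, EM) p u).toLinearMap

/-- The tangent map `T_u (r^g)` of the principal right action. -/
def tangentRt (g : G) (u : P) :
    TangentSpace 𝓘(ℝ, EP) u →L[ℝ] TangentSpace 𝓘(ℝ, EP) (rt g u) :=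
  mfderiv 𝓘(ℝ, EP) 𝓘(ℝ, EP) (fun v : P => rt g v) u

/-- The fundamental vector field `ζ_X(u) = T_e (r_u) X`, where `r_u g = u.g`. -/
def fundField (X : Lie EG G) (u : P) : TangentSpace 𝓘(ℝ, EP) u :=
  mfderiv 𝓘(ℝ, EG) 𝓘(ℝ, EP) (fun g : G => rt g u) 1 X

/-- A principal Cartan connection: a Cartan connection of type `𝔥/𝔤` on `P` that is `G`-equivariant
and extends the vertical parallelism `ζ_X(u) ↦ X`, the inverse of `T_e (r_u) : 𝔤 → V_u P`. -/
structure IsPrincipalCartanConnection [IsManifold 𝓘(ℝ, EP) ∞ P]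
    {EH : Type*} [NormedAddCommGroup EH] [NormedSpace ℝ EH]
    {H : Type*} [TopologicalSpace H] [ChartedSpace EH H] [Group H]
    (EG : Type*) [NormedAddCommGroup EG] [NormedSpace ℝ EG] [ChartedSpace EG G]
    (ι : G →* H) (κ : Form EP P (Lie EH H)) : Prop
    extends IsCartanConnection (subAlg EG EH ι) κ where
  vertical_eq : ∀ (u : P) (X : Lie EG G), κ u (fundField X u) = dHom EG EH ι X
  equivariant : ∀ (g : G) (u : P) (ξ : TangentSpace 𝓘(ℝ, EP) u),
    κ (rt g u) (tangentRt g u ξ) = Ad (ι g⁻¹) (κ u ξ)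

/-- A principal connection form. -/
structure IsConnectionForm [IsManifold 𝓘(ℝ, EP) ∞ P] (om : Form EP P (Lie EG G)) : Prop where
  smooth : IsSmoothForm om
  vertical_eq : ∀ (u : P) (X : Lie EG G), om u (fundField X u) = X
  equivariant : ∀ (g : G) (u : P) (ξ : TangentSpace 𝓘(ℝ, EP) u),
    om (rt g u) (tangentRt g u ξ) = Ad g⁻¹ (om u ξ)

/-- A displacement form: a `V`-valued 1-form that is `G`-equivariant and strictly horizontal. -/
structure IsDisplacementForm [IsManifold 𝓘(ℝ, EP) ∞ P]
    (EM : Type*) [NormedAddCommGroup EM] [NormedSpace ℝ EM] [ChartedSpace EM M]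
    {V : Type*} [AddCommGroup V] [Module ℝ V] (ρ : Representation ℝ G V)
    (p : P → M) (θ : Form EP P V) : Prop where
  smooth : IsSmoothForm θ
  equivariant : ∀ (g : G) (u : P) (ξ : TangentSpace 𝓘(ℝ, EP) u),
    θ (rt g u) (tangentRt g u ξ) = ρ g⁻¹ (θ u ξ)
  ker_eq : ∀ u : P, LinearMap.ker (θ u) = vertical EP EM p u

/-- `(p : P → M, θ)` is a `G`-structure, where `G` is a linear Lie group through the faithful
smooth representation `ρ` in `V`, and `dim M = dim V`. -/
structure IsGStructure [IsManifold 𝓘(ℝ, EP) ∞ P]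
    (EG : Type*) [NormedAddCommGroup EG] [NormedSpace ℝ EG] [ChartedSpace EG G]
    (EM : Type*) [NormedAddCommGroup EM] [NormedSpace ℝ EM] [ChartedSpace EM M]
    {V : Type*} [AddCommGroup V] [Module ℝ V] (ρ : Representation ℝ G V)
    (p : P → M) (θ : Form EP P V) : Prop where
  faithful : Function.Injective ρ
  smooth_rep : ∀ (v : V) (ℓ : Module.Dual ℝ V),
    ContMDiff 𝓘(ℝ, EG) 𝓘(ℝ) ∞ (fun g : G => ℓ (ρ g v))
  principal : IsPrincipalBundle EG G EP EM p
  dim_eq : ∀ x : M, Module.finrank ℝ (TangentSpace 𝓘(ℝ, EM) x) = Module.finrank ℝ V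
  displacement : IsDisplacementForm EM ρ p θ

end Bundles

end CartanConn

end

/-!
A vector field `W` on a manifold with a right action is transported by the action along the orbit
of `u₀` if `W (u₀.n) = T(r^n) (a n)` for some `a : N → T_{u₀}`. Its bracket with the infinitesimal
generator `Z` of a one-parameter direction `Y` is then `[Z, W] = T a Y`: in a chart the second
derivatives of the action cancel by symmetry. Applied to right multiplication on `H`, this gives
`[Y, X] = d(Ad(·)X) Y`. Applied to the principal action, with `Z = ζ_Y` and `W = ζ^κ_X`, where
equivariance of `κ` makes `a g = κ_u⁻¹ (Ad(g) X)`, it gives `[ζ_Y, ζ^κ_X] = κ_u⁻¹ [Y, X]`. So the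
bracket condition in the definition of a principal Cartan connection follows from equivariance and
verticality, and what remains is linear algebra: the components of `κ` along the `Ad(G)`-stable
decomposition `𝔥 = V ⊕ 𝔤` are equivariant, `VP = {ζ_X}` is the preimage of `𝔤` under `κ`, and
dimensions are compared in `𝔥 = V ⊕ 𝔤` and in a local product `P ≅ M × G`.
-/

namespace CartanConn

open Filter VectorField
open scoped Topology

section ModelSpace

variable {E F : Type*} [NormedAddCommGroup E] [NormedSpace ℝ E] [NormedAddCommGroup F]
  [NormedSpace ℝ F]

theorem fderiv_apply_prodMk_zero {E' : Type*} [NormedAddCommGroup E'] [NormedSpace ℝ E']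
    {ρ : E × F → E'} {x : E} {f : F} (hρ : DifferentiableAt ℝ ρ (x, f)) (v : E) :
    fderiv ℝ ρ (x, f) (v, 0) = fderiv ℝ (fun y => ρ (y, f)) x v := by
  have h : HasFDerivAt (fun y => ρ (y, f)) _ x :=
    hρ.hasFDerivAt.comp x (hasFDerivAt_prodMk_left x f)
  simp [h.fderiv]

theorem fderiv_apply_zero_prodMk {E' : Type*} [NormedAddCommGroup E'] [NormedSpace ℝ E']
    {ρ : E × F → E'} {x : E} {f : F} (hρ : DifferentiableAt ℝ ρ (x, f)) (v : F) :
    fderiv ℝ ρ (x, f) (0, v) = fderiv ℝ (fun g => ρ (x, g)) f v := by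
  have h : HasFDerivAt (fun g => ρ (x, g)) _ f :=
    hρ.hasFDerivAt.comp f (hasFDerivAt_prodMk_right x f)
  simp [h.fderiv]

variable {ρ : E × F → E} {x₀ : E} {f₀ : F}

theorem fderiv_generator_apply (hρ : ContDiffAt ℝ 2 ρ (x₀, f₀)) {Z : E → E} {Y : F}
    (hZ : ∀ᶠ x in 𝓝 x₀, Z x = fderiv ℝ (fun f => ρ (x, f)) f₀ Y) (v : E) :
    fderiv ℝ Z x₀ v = fderiv ℝ (fderiv ℝ ρ) (x₀, f₀) (v, 0) (0, Y) := by
  have hρ' : ∀ᶠ x in 𝓝 x₀, DifferentiableAt ℝ ρ (x, f₀) :=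
    (Continuous.prodMk_left f₀).continuousAt.eventually <|
      (hρ.eventually (by simp)).mono fun q hq => hq.differentiableAt (by simp)
  have hZ' : Z =ᶠ[𝓝 x₀] fun x => fderiv ℝ ρ (x, f₀) (0, Y) := by
    filter_upwards [hZ, hρ'] with x hx hd
    rw [hx, fderiv_apply_zero_prodMk hd]
  have hd : DifferentiableAt ℝ (fderiv ℝ ρ) (x₀, f₀) :=
    (hρ.fderiv_right (m := 1) (by norm_num)).differentiableAt (by simp)
  have h : HasFDerivAt (fun x => fderiv ℝ ρ (x, f₀) (0, Y)) _ x₀ :=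
    (hd.hasFDerivAt.comp x₀ (hasFDerivAt_prodMk_left x₀ f₀)).clm_apply
      (hasFDerivAt_const ((0, Y) : E × F) x₀)
  simp [hZ'.fderiv_eq, h.fderiv]

theorem fderiv_apply_of_transported (hρ : ContDiffAt ℝ 2 ρ (x₀, f₀))
    (hid : ∀ᶠ x in 𝓝 x₀, ρ (x, f₀) = x) {W : E → E} (hW : DifferentiableAt ℝ W x₀)
    {a : F → E} (ha : DifferentiableAt ℝ a f₀)
    (hWa : ∀ᶠ f in 𝓝 f₀, W (ρ (x₀, f)) = fderiv ℝ (fun x => ρ (x, f)) x₀ (a f)) (Y : F) :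
    fderiv ℝ W x₀ (fderiv ℝ (fun f => ρ (x₀, f)) f₀ Y) =
      fderiv ℝ (fderiv ℝ ρ) (x₀, f₀) (0, Y) (W x₀, 0) + fderiv ℝ a f₀ Y := by
  have hd : DifferentiableAt ℝ ρ (x₀, f₀) := hρ.differentiableAt (by simp)
  have hd₂ : DifferentiableAt ℝ (fderiv ℝ ρ) (x₀, f₀) :=
    (hρ.fderiv_right (m := 1) (by norm_num)).differentiableAt (by simp)
  have hρ' : ∀ᶠ f in 𝓝 f₀, DifferentiableAt ℝ ρ (x₀, f) :=
    (Continuous.prodMk_right x₀).continuousAt.eventually <|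
      (hρ.eventually (by simp)).mono fun q hq => hq.differentiableAt (by simp)
  have hx₀ : ρ (x₀, f₀) = x₀ := hid.self_of_nhds
  have h_id : ∀ v, fderiv ℝ ρ (x₀, f₀) (v, 0) = v := fun v => by
    rw [fderiv_apply_prodMk_zero hd, EventuallyEq.fderiv_eq (f := id) hid, fderiv_id]
    rfl
  have ha₀ : a f₀ = W x₀ := by
    rw [← h_id (a f₀), fderiv_apply_prodMk_zero hd, ← hWa.self_of_nhds, hx₀]
  have hWρ : HasFDerivAt (fun f => W (ρ (x₀, f))) _ f₀ :=
    HasFDerivAt.comp f₀ (g := W) (by rw [hx₀]; exact hW.hasFDerivAt)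
      (hd.hasFDerivAt.comp f₀ (hasFDerivAt_prodMk_right x₀ f₀))
  have hρa : HasFDerivAt (fun f => fderiv ℝ ρ (x₀, f) (a f, 0)) _ f₀ :=
    (hd₂.hasFDerivAt.comp f₀ (hasFDerivAt_prodMk_right x₀ f₀)).clm_apply
      (ha.hasFDerivAt.prodMk (hasFDerivAt_const 0 f₀))
  have hWa' : (fun f => W (ρ (x₀, f))) =ᶠ[𝓝 f₀] fun f => fderiv ℝ ρ (x₀, f) (a f, 0) := by
    filter_upwards [hWa, hρ'] with f hf hdf
    rw [hf, fderiv_apply_prodMk_zero hdf]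
  have h := congrArg (fun l => l Y) (hWρ.unique (hρa.congr_of_eventuallyEq hWa'))
  simpa [h_id, ha₀, fderiv_apply_zero_prodMk hd, add_comm] using h

theorem lieBracket_eq_fderiv_of_transported (hρ : ContDiffAt ℝ 2 ρ (x₀, f₀))
    (hid : ∀ᶠ x in 𝓝 x₀, ρ (x, f₀) = x) {Z W : E → E} {Y : F}
    (hZ : ∀ᶠ x in 𝓝 x₀, Z x = fderiv ℝ (fun f => ρ (x, f)) f₀ Y)
    (hW : DifferentiableAt ℝ W x₀) {a : F → E} (ha : DifferentiableAt ℝ a f₀)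
    (hWa : ∀ᶠ f in 𝓝 f₀, W (ρ (x₀, f)) = fderiv ℝ (fun x => ρ (x, f)) x₀ (a f)) :
    lieBracket ℝ Z W x₀ = fderiv ℝ a f₀ Y := by
  have hsymm : IsSymmSndFDerivAt ℝ ρ (x₀, f₀) := hρ.isSymmSndFDerivAt (by simp)
  rw [lieBracket, fderiv_generator_apply hρ hZ, hZ.self_of_nhds,
    fderiv_apply_of_transported hρ hid hW ha hWa, hsymm.eq, add_sub_cancel_left]

end ModelSpace

section Charts

variable {E : Type*} [NormedAddCommGroup E] [NormedSpace ℝ E]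
  {M : Type*} [TopologicalSpace M] [ChartedSpace E M]

theorem differentiableAt_comp_extChartAt_symm {E' : Type*} [NormedAddCommGroup E']
    [NormedSpace ℝ E'] {F : M → E'} {x : M} (hF : MDifferentiableAt 𝓘(ℝ, E) 𝓘(ℝ, E') F x) :
    DifferentiableAt ℝ (F ∘ (extChartAt 𝓘(ℝ, E) x).symm) (extChartAt 𝓘(ℝ, E) x x) := by
  simpa only [writtenInExtChartAt, extChartAt_model_space_eq_id, PartialEquiv.refl_coe,
    Function.id_comp, modelWithCornersSelf_coe, Set.range_id, differentiableWithinAt_univ]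
    using hF.differentiableWithinAt_writtenInExtChartAt

theorem fderiv_comp_extChartAt_symm {E' : Type*} [NormedAddCommGroup E'] [NormedSpace ℝ E']
    {F : M → E'} {x : M} (hF : MDifferentiableAt 𝓘(ℝ, E) 𝓘(ℝ, E') F x) :
    fderiv ℝ (F ∘ (extChartAt 𝓘(ℝ, E) x).symm) (extChartAt 𝓘(ℝ, E) x x) =
      mfderiv 𝓘(ℝ, E) 𝓘(ℝ, E') F x := by
  simp only [hF.mfderiv, writtenInExtChartAt, extChartAt_model_space_eq_id,
    PartialEquiv.refl_coe, Function.id_comp, modelWithCornersSelf_coe, Set.range_id,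
    fderivWithin_univ]

variable [IsManifold 𝓘(ℝ, E) 1 M]

theorem mdifferentiableAt_extChartAt_of_mem {x y : M} (hy : y ∈ (extChartAt 𝓘(ℝ, E) x).source) :
    MDifferentiableAt 𝓘(ℝ, E) 𝓘(ℝ, E) (extChartAt 𝓘(ℝ, E) x) y :=
  mdifferentiableAt_extChartAt (extChartAt_source 𝓘(ℝ, E) x ▸ hy)

theorem mpullback_extChartAt_symm_apply (W : ∀ y : M, TangentSpace 𝓘(ℝ, E) y) {x y : M}
    (hy : y ∈ (extChartAt 𝓘(ℝ, E) x).source) :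
    mpullback 𝓘(ℝ, E) 𝓘(ℝ, E) (extChartAt 𝓘(ℝ, E) x).symm W (extChartAt 𝓘(ℝ, E) x y) =
      mfderiv 𝓘(ℝ, E) 𝓘(ℝ, E) (extChartAt 𝓘(ℝ, E) x) y (W y) := by
  have hinv : (mfderiv 𝓘(ℝ, E) 𝓘(ℝ, E) (extChartAt 𝓘(ℝ, E) x).symm
      (extChartAt 𝓘(ℝ, E) x y)).inverse =
        mfderiv 𝓘(ℝ, E) 𝓘(ℝ, E) (extChartAt 𝓘(ℝ, E) x) y := by
    have h₁ := mfderivWithin_extChartAt_symm_comp_mfderiv_extChartAt' (I := 𝓘(ℝ, E)) hy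
    have h₂ := mfderiv_extChartAt_comp_mfderivWithin_extChartAt_symm' (I := 𝓘(ℝ, E)) hy
    simp only [modelWithCornersSelf_coe, Set.range_id, mfderivWithin_univ] at h₁ h₂
    exact ContinuousLinearMap.inverse_eq h₁ h₂
  rw [mpullback_apply, hinv, (extChartAt 𝓘(ℝ, E) x).left_inv hy]

theorem mlieBracket_eq_lieBracket_mpullback (V W : ∀ y : M, TangentSpace 𝓘(ℝ, E) y) (x : M) :
    mlieBracket 𝓘(ℝ, E) V W x =
      lieBracket ℝ (mpullback 𝓘(ℝ, E) 𝓘(ℝ, E) (extChartAt 𝓘(ℝ, E) x).symm V)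
        (mpullback 𝓘(ℝ, E) 𝓘(ℝ, E) (extChartAt 𝓘(ℝ, E) x).symm W)
        (extChartAt 𝓘(ℝ, E) x x) := by
  rw [← mlieBracketWithin_univ, mlieBracketWithin_apply, mfderiv_extChartAt_self]
  simp only [modelWithCornersSelf_coe, Set.range_id, Set.preimage_univ, Set.univ_inter,
    mpullbackWithin_univ]
  have hid : (ContinuousLinearMap.id ℝ E).inverse = .id ℝ E := ContinuousLinearMap.inverse_id
  exact (DFunLike.congr_fun hid _).trans (congrFun (lieBracketWithin_univ (𝕜 := ℝ) (E := E)) _)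

theorem differentiableAt_mpullback_extChartAt_symm [IsManifold 𝓘(ℝ, E) 2 M] [CompleteSpace E]
    {W : ∀ y : M, TangentSpace 𝓘(ℝ, E) y} {x : M}
    (hW : MDifferentiableAt 𝓘(ℝ, E) 𝓘(ℝ, E).tangent
      (fun y => (W y : TangentBundle 𝓘(ℝ, E) M)) x) :
    DifferentiableAt ℝ (mpullback 𝓘(ℝ, E) 𝓘(ℝ, E) (extChartAt 𝓘(ℝ, E) x).symm W)
      (extChartAt 𝓘(ℝ, E) x x) := by
  have h := (mdifferentiableWithinAt_univ.2
    hW).differentiableWithinAt_mpullbackWithin_vectorField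
  simp only [modelWithCornersSelf_coe, Set.range_id, Set.preimage_univ, Set.univ_inter,
    mpullbackWithin_univ] at h
  exact h.differentiableAt Filter.univ_mem

end Charts

section Generators

variable {E : Type*} [NormedAddCommGroup E] [NormedSpace ℝ E]
  {M : Type*} [TopologicalSpace M] [ChartedSpace E M]
  {F : Type*} [NormedAddCommGroup F] [NormedSpace ℝ F]
  {N : Type*} [TopologicalSpace N] [ChartedSpace F N]

theorem mpullback_extChartAt_symm_apply_of_eq_mfderiv [IsManifold 𝓘(ℝ, E) 1 M] {c : N → M}
    {n : N} {x : M} (hc : MDifferentiableAt 𝓘(ℝ, F) 𝓘(ℝ, E) c n)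
    (hcx : c n ∈ (extChartAt 𝓘(ℝ, E) x).source) {W : ∀ y : M, TangentSpace 𝓘(ℝ, E) y}
    {v : TangentSpace 𝓘(ℝ, F) n} (hW : W (c n) = mfderiv 𝓘(ℝ, F) 𝓘(ℝ, E) c n v) :
    mpullback 𝓘(ℝ, E) 𝓘(ℝ, E) (extChartAt 𝓘(ℝ, E) x).symm W (extChartAt 𝓘(ℝ, E) x (c n)) =
      fderiv ℝ (fun f => extChartAt 𝓘(ℝ, E) x (c ((extChartAt 𝓘(ℝ, F) n).symm f)))
        (extChartAt 𝓘(ℝ, F) n n) v := by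
  have hφ := mdifferentiableAt_extChartAt_of_mem hcx
  rw [mpullback_extChartAt_symm_apply W hcx, hW, ← mfderiv_comp_apply n hφ hc,
    ← fderiv_comp_extChartAt_symm (hφ.comp n hc)]
  rfl

theorem contDiffAt_extChartAt_comp_extChartAt_symm [IsManifold 𝓘(ℝ, E) 2 M]
    [IsManifold 𝓘(ℝ, F) 2 N] {ρ : M × N → M}
    (hρ : ContMDiff (𝓘(ℝ, E).prod 𝓘(ℝ, F)) 𝓘(ℝ, E) 2 ρ) {e : N} {u : M} (hu : ρ (u, e) = u) :
    ContDiffAt ℝ 2 (fun q : E × F => extChartAt 𝓘(ℝ, E) u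
        (ρ ((extChartAt 𝓘(ℝ, E) u).symm q.1, (extChartAt 𝓘(ℝ, F) e).symm q.2)))
      (extChartAt 𝓘(ℝ, E) u u, extChartAt 𝓘(ℝ, F) e e) := by
  have hφ : ContMDiffAt 𝓘(ℝ, E) 𝓘(ℝ, E) 2 (extChartAt 𝓘(ℝ, E) u) (ρ (u, e)) := by
    rw [hu]
    exact contMDiffAt_extChartAt
  have h := (contMDiffAt_iff_source.1 (hφ.comp (u, e) hρ.contMDiffAt)).contMDiffAt
    (x := extChartAt (𝓘(ℝ, E).prod 𝓘(ℝ, F)) (u, e) (u, e)) (by simp)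
  rw [← modelWithCornersSelf_prod] at h
  exact contMDiffAt_iff_contDiffAt.1 (chartedSpaceSelf_prod (H := E) (H' := F) ▸ h)

theorem mlieBracket_eq_mfderiv_of_transported [IsManifold 𝓘(ℝ, E) 2 M] [CompleteSpace E]
    [IsManifold 𝓘(ℝ, F) 2 N] {ρ : M × N → M}
    (hρ : ContMDiff (𝓘(ℝ, E).prod 𝓘(ℝ, F)) 𝓘(ℝ, E) 2 ρ) {e : N} (hid : ∀ u, ρ (u, e) = u)
    {Z W : ∀ u : M, TangentSpace 𝓘(ℝ, E) u} {Y : TangentSpace 𝓘(ℝ, F) e}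
    (hZ : ∀ u, Z (ρ (u, e)) = mfderiv 𝓘(ℝ, F) 𝓘(ℝ, E) (fun n => ρ (u, n)) e Y) {u₀ : M}
    (hW : MDifferentiableAt 𝓘(ℝ, E) 𝓘(ℝ, E).tangent
      (fun u => (W u : TangentBundle 𝓘(ℝ, E) M)) u₀)
    {a : N → E} (ha : MDifferentiableAt 𝓘(ℝ, F) 𝓘(ℝ, E) a e)
    (hWa : ∀ n, W (ρ (u₀, n)) = mfderiv 𝓘(ℝ, E) 𝓘(ℝ, E) (fun u => ρ (u, n)) u₀ (a n)) :
    mlieBracket 𝓘(ℝ, E) Z W u₀ = mfderiv 𝓘(ℝ, F) 𝓘(ℝ, E) a e Y := by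
  have : IsManifold 𝓘(ℝ, E) 1 M := IsManifold.of_le (n := 2) (by norm_num)
  set φ := extChartAt 𝓘(ℝ, E) u₀
  set ψ := extChartAt 𝓘(ℝ, F) e
  have hφ : φ.symm (φ u₀) = u₀ := extChartAt_to_inv u₀
  have hψ : ψ.symm (ψ e) = e := extChartAt_to_inv e
  have hρ₁ : ∀ u, MDifferentiable 𝓘(ℝ, F) 𝓘(ℝ, E) (fun n => ρ (u, n)) := fun u =>
    (hρ.comp (contMDiff_const.prodMk contMDiff_id)).mdifferentiable (by simp)
  have hρ₂ : ∀ n, MDifferentiable 𝓘(ℝ, E) 𝓘(ℝ, E) (fun u => ρ (u, n)) := fun n =>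
    (hρ.comp (contMDiff_id.prodMk contMDiff_const)).mdifferentiable (by simp)
  have hsource : ∀ᶠ f in 𝓝 (ψ e), ρ (u₀, ψ.symm f) ∈ φ.source := by
    have hc : ContinuousAt (fun f => ρ (u₀, ψ.symm f)) (ψ e) :=
      (hρ₁ u₀).continuous.continuousAt.comp (continuousAt_extChartAt_symm e)
    refine hc.eventually ((isOpen_extChartAt_source u₀).mem_nhds ?_)
    simp only [hψ, hid]
    exact mem_extChartAt_source u₀
  have hbracket := mlieBracket_eq_lieBracket_mpullback Z W u₀
  have hderiv := DFunLike.congr_fun (fderiv_comp_extChartAt_symm ha) Y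
  refine hbracket.trans (Eq.trans ?_ hderiv)
  refine lieBracket_eq_fderiv_of_transported
    (ρ := fun q : E × F => φ (ρ (φ.symm q.1, ψ.symm q.2)))
    (contDiffAt_extChartAt_comp_extChartAt_symm hρ (hid u₀)) ?_ ?_
    (differentiableAt_mpullback_extChartAt_symm hW) (differentiableAt_comp_extChartAt_symm ha) ?_
  · filter_upwards [extChartAt_target_mem_nhds u₀] with x hx
    change φ (ρ (φ.symm x, ψ.symm (ψ e))) = x
    rw [hψ, hid, φ.right_inv hx]
  · filter_upwards [extChartAt_target_mem_nhds u₀] with x hx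
    have hZx := mpullback_extChartAt_symm_apply_of_eq_mfderiv (x := u₀) (hρ₁ (φ.symm x) e)
      (by rw [hid]; exact φ.map_target hx) (hZ _)
    rwa [hid, φ.right_inv hx] at hZx
  · filter_upwards [hsource] with f hf
    rw [hφ]
    exact mpullback_extChartAt_symm_apply_of_eq_mfderiv (x := u₀) (hρ₂ (ψ.symm f) u₀) hf (hWa _)

end Generators

section AdjointAction

section ConstantFootPoint

variable {E : Type*} [NormedAddCommGroup E] [NormedSpace ℝ E]
  {M : Type*} [TopologicalSpace M] [ChartedSpace E M] [IsManifold 𝓘(ℝ, E) 1 M]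
  {E' : Type*} [NormedAddCommGroup E'] [NormedSpace ℝ E']
  {M' : Type*} [TopologicalSpace M'] [ChartedSpace E' M'] [IsManifold 𝓘(ℝ, E') 1 M']

theorem inTangentCoordinates_of_eq_const {N : Type*} {g : N → M'} {x : M} {y : M'}
    (hg : ∀ k, g k = y) (ϕ : N → E →L[ℝ] E') (k₀ k : N) :
    inTangentCoordinates 𝓘(ℝ, E) 𝓘(ℝ, E') (fun _ => x) g ϕ k₀ k = ϕ k := by
  obtain rfl : g = fun _ => y := funext hg
  rw [inTangentCoordinates_eq (fun _ => x) (fun _ => y) ϕ (mem_chart_source E x)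
    (mem_chart_source E' y)]
  ext v
  simp only [ContinuousLinearMap.comp_apply]
  rw [(tangentBundleCore 𝓘(ℝ, E) M).coordChange_self _ _ (mem_chart_source E x),
    (tangentBundleCore 𝓘(ℝ, E') M').coordChange_self _ _ (mem_chart_source E' y)]

theorem contMDiff_mfderiv_apply_of_const
    {F : Type*} [NormedAddCommGroup F] [NormedSpace ℝ F]
    {N : Type*} [TopologicalSpace N] [ChartedSpace F N] [IsManifold 𝓘(ℝ, F) 1 N]
    {m n : WithTop ℕ∞} (hmn : m + 1 ≤ n) {f : N → M → M'}
    (hf : ContMDiff (𝓘(ℝ, F).prod 𝓘(ℝ, E)) 𝓘(ℝ, E') n (Function.uncurry f)) {x : M} {y : M'}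
    (hxy : ∀ k, f k x = y) (v : E) :
    ContMDiff 𝓘(ℝ, F) 𝓘(ℝ, E') m (fun k => (mfderiv 𝓘(ℝ, E) 𝓘(ℝ, E') (f k) x v : E')) := by
  intro k₀
  let ϕ : N → E →L[ℝ] E' := fun k => mfderiv 𝓘(ℝ, E) 𝓘(ℝ, E') (f k) x
  have hϕ : ContMDiffAt 𝓘(ℝ, F) 𝓘(ℝ, E →L[ℝ] E') m ϕ k₀ :=
    (hf.contMDiffAt.mfderiv f (fun _ => x) contMDiffAt_const hmn).congr_of_eventuallyEq <|
      Eventually.of_forall fun k => (inTangentCoordinates_of_eq_const hxy ϕ k₀ k).symm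
  exact hϕ.clm_apply contMDiffAt_const

end ConstantFootPoint

variable {EH : Type*} [NormedAddCommGroup EH] [NormedSpace ℝ EH]
  {H : Type*} [TopologicalSpace H] [ChartedSpace EH H] [Group H]

/-- The orbit map `h ↦ Ad h X` of the adjoint action, with values in the model space `EH` of the
Lie algebra, which carries the norm needed to differentiate it. -/
noncomputable def adOrbit (X : Lie EH H) : H → EH := fun h => Ad h X

variable [LieGroup 𝓘(ℝ, EH) ∞ H]

theorem contMDiff_conj (h : H) : ContMDiff 𝓘(ℝ, EH) 𝓘(ℝ, EH) ∞ (fun x : H => h * x * h⁻¹) :=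
  (contMDiff_const.mul contMDiff_id).mul contMDiff_const

theorem contMDiff_adOrbit (X : Lie EH H) : ContMDiff 𝓘(ℝ, EH) 𝓘(ℝ, EH) ∞ (adOrbit X) := by
  have : IsManifold 𝓘(ℝ, EH) ∞ H := ContMDiffMul.toIsManifold
  have hconj : ContMDiff (𝓘(ℝ, EH).prod 𝓘(ℝ, EH)) 𝓘(ℝ, EH) ∞
      (Function.uncurry fun h x : H => h * x * h⁻¹) :=
    (contMDiff_fst.mul contMDiff_snd).mul contMDiff_fst.inv
  exact contMDiff_mfderiv_apply_of_const (by simp) hconj (y := 1) (by simp) X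

theorem mulInvariantVectorField_eq_mfderiv_mul_right_Ad (X : Lie EH H) (h : H) :
    mulInvariantVectorField X h = mfderiv 𝓘(ℝ, EH) 𝓘(ℝ, EH) (fun x : H => x * h) 1 (Ad h X) := by
  have hmul : MDifferentiableAt 𝓘(ℝ, EH) 𝓘(ℝ, EH) (fun x : H => x * h) 1 :=
    (contMDiff_mul_right (n := ∞)).mdifferentiableAt (by simp)
  have hcomp := mfderiv_comp_apply_of_eq (1 : H) (f := fun x => h * x * h⁻¹) hmul
    ((contMDiff_conj h).mdifferentiableAt (by simp)) (by simp) X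
  have hfun : (fun x : H => x * h) ∘ (fun x => h * x * h⁻¹) = fun x => h * x := by
    ext x
    simp
  rw [hfun] at hcomp
  exact hcomp

theorem lie_eq_mfderiv_adOrbit [CompleteSpace EH] (Y X : Lie EH H) :
    ⁅Y, X⁆ = mfderiv 𝓘(ℝ, EH) 𝓘(ℝ, EH) (adOrbit X) 1 Y := by
  have : IsManifold 𝓘(ℝ, EH) ∞ H := ContMDiffMul.toIsManifold
  have : LieGroup 𝓘(ℝ, EH) (minSmoothness ℝ 3) H := by
    rw [minSmoothness_of_isRCLikeNormedField]
    exact LieGroup.of_le (n := ∞) ENat.LEInfty.out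
  rw [GroupLieAlgebra.bracket_def]
  refine mlieBracket_eq_mfderiv_of_transported (ρ := fun q : H × H => q.1 * q.2)
    (contMDiff_mul _ _) mul_one (fun u => ?_) (mdifferentiableAt_mulInvariantVectorField X)
    ((contMDiff_adOrbit X).mdifferentiableAt (by simp)) fun h => ?_
  · rw [mul_one]
    rfl
  · rw [one_mul]
    exact mulInvariantVectorField_eq_mfderiv_mul_right_Ad X h

variable {EG : Type*} [NormedAddCommGroup EG] [NormedSpace ℝ EG]
  {G : Type*} [TopologicalSpace G] [ChartedSpace EG G] [Group G] {ι : G →* H}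

theorem Ad_dHom [LieGroup 𝓘(ℝ, EG) ∞ G] (hι : ContMDiff 𝓘(ℝ, EG) 𝓘(ℝ, EH) ∞ ι) (g : G)
    (X : Lie EG G) : Ad (ι g) (dHom EG EH ι X) = dHom EG EH ι (Ad g X) := by
  have hιd : MDifferentiable 𝓘(ℝ, EG) 𝓘(ℝ, EH) ι := hι.mdifferentiable (by simp)
  have hAd := mfderiv_comp_apply_of_eq (1 : G) (f := ι)
    ((contMDiff_conj (ι g)).mdifferentiableAt (by simp)) (hιd 1) (map_one ι) X
  have hdHom := mfderiv_comp_apply_of_eq (1 : G) (f := fun x => g * x * g⁻¹)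
    (hιd 1) ((contMDiff_conj g).mdifferentiableAt (by simp)) (by simp) X
  have hfun : (fun x => ι g * x * (ι g)⁻¹) ∘ ι = ι ∘ fun x => g * x * g⁻¹ := by
    ext x
    simp
  rw [hfun] at hAd
  exact hAd.symm.trans hdHom

theorem lie_dHom_eq_mfderiv_adOrbit [CompleteSpace EH]
    (hι : ContMDiff 𝓘(ℝ, EG) 𝓘(ℝ, EH) ∞ ι) (Y : Lie EG G) (X : Lie EH H) :
    ⁅dHom EG EH ι Y, X⁆ = mfderiv 𝓘(ℝ, EG) 𝓘(ℝ, EH) (adOrbit X ∘ ι) 1 Y := by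
  rw [lie_eq_mfderiv_adOrbit]
  exact (mfderiv_comp_apply_of_eq 1 ((contMDiff_adOrbit X).mdifferentiableAt (by simp))
    (hι.mdifferentiableAt (by simp)) (map_one ι) Y).symm

end AdjointAction

section ParallelFields

section Smoothness

variable {E : Type*} [NormedAddCommGroup E] [NormedSpace ℝ E]
  {B : Type*} [TopologicalSpace B] [ChartedSpace E B]
  {F : Type*} [NormedAddCommGroup F] [NormedSpace ℝ F] [FiniteDimensional ℝ F]
  {n : WithTop ℕ∞} {x₀ : B}

theorem contMDiffAt_of_forall_dual {f : B → F}
    (hf : ∀ ℓ : Module.Dual ℝ F, ContMDiffAt 𝓘(ℝ, E) 𝓘(ℝ) n (fun x => ℓ (f x)) x₀) :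
    ContMDiffAt 𝓘(ℝ, E) 𝓘(ℝ, F) n f x₀ := by
  let b := (Module.finBasis ℝ F).equivFunL
  have hcoord : ContMDiffAt 𝓘(ℝ, E) 𝓘(ℝ, Fin (Module.finrank ℝ F) → ℝ) n (fun x => b (f x)) x₀ :=
    contMDiffAt_pi_space.2 fun i => hf (LinearMap.proj i ∘ₗ b.toLinearMap)
  simpa only [Function.comp_def, b.symm_apply_apply] using
    b.symm.contDiff.contMDiff.contMDiffAt.comp x₀ hcoord

theorem contMDiffAt_clm_of_forall_apply {F' : Type*} [NormedAddCommGroup F'] [NormedSpace ℝ F']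
    {A : B → F →L[ℝ] F'} (hA : ∀ v, ContMDiffAt 𝓘(ℝ, E) 𝓘(ℝ, F') n (fun x => A x v) x₀) :
    ContMDiffAt 𝓘(ℝ, E) 𝓘(ℝ, F →L[ℝ] F') n A x₀ := by
  let b : F ≃L[ℝ] (Fin (Module.finrank ℝ F) → ℝ) := (Module.finBasis ℝ F).equivFunL
  let c := (b.arrowCongr (1 : F' ≃L[ℝ] F')).trans
    (ContinuousLinearEquiv.piRing (Fin (Module.finrank ℝ F)))
  have hcoord : ContMDiffAt 𝓘(ℝ, E) 𝓘(ℝ, Fin (Module.finrank ℝ F) → F') n (fun x => c (A x)) x₀ :=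
    contMDiffAt_pi_space.2 fun i => hA _
  simpa only [Function.comp_def, c.symm_apply_apply] using
    c.symm.contDiff.contMDiff.contMDiffAt.comp x₀ hcoord

end Smoothness

variable {EP : Type*} [NormedAddCommGroup EP] [NormedSpace ℝ EP]
  {P : Type*} [TopologicalSpace P] [ChartedSpace EP P]
  {W : Type*} [AddCommGroup W] [Module ℝ W] {κ : Form EP P W}

theorem apply_parallelField (hκ : ∀ u, Function.Bijective (κ u)) (X : W) (u : P) :
    κ u (parallelField κ hκ X u) = X :=
  (LinearEquiv.ofBijective (κ u) (hκ u)).apply_symm_apply X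

theorem parallelField_eq_iff (hκ : ∀ u, Function.Bijective (κ u)) {X : W} {u : P}
    {ξ : TangentSpace 𝓘(ℝ, EP) u} : parallelField κ hκ X u = ξ ↔ X = κ u ξ :=
  (LinearEquiv.ofBijective (κ u) (hκ u)).symm_apply_eq

variable [IsManifold 𝓘(ℝ, EP) ∞ P]

theorem contMDiffAt_trivializationAt_symmₗ {u₀ u : P}
    (hu : u ∈ (trivializationAt EP (TangentSpace 𝓘(ℝ, EP)) u₀).baseSet) (v : EP) :
    ContMDiffAt 𝓘(ℝ, EP) 𝓘(ℝ, EP).tangent ∞ (fun y => (⟨y,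
      (trivializationAt EP (TangentSpace 𝓘(ℝ, EP)) u₀).symmₗ ℝ y v⟩ : TangentBundle 𝓘(ℝ, EP) P))
      u := by
  let e := trivializationAt EP (TangentSpace 𝓘(ℝ, EP) (M := P)) u₀
  refine (e.contMDiffAt_section_iff hu).2 ((contMDiffAt_const (c := v)).congr_of_eventuallyEq ?_)
  filter_upwards [e.open_baseSet.mem_nhds hu] with y hy
  rw [e.symmₗ_apply hy, e.apply_mk_symm hy]

variable [FiniteDimensional ℝ EP]

/-- The form `κ` near `u₀` as a matrix-valued function: `κ u` is read in the trivialization of `TP`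
at `u₀` on one side, and its values are brought back to the model space by `(κ u₀)⁻¹` on the
other. -/
noncomputable def formInTrivialization (κ : Form EP P W) (hκ : ∀ u, Function.Bijective (κ u))
    (u₀ u : P) : EP →L[ℝ] EP :=
  LinearMap.toContinuousLinearMap ((LinearEquiv.ofBijective (κ u₀) (hκ u₀)).symm.toLinearMap ∘ₗ
    κ u ∘ₗ (trivializationAt EP (TangentSpace 𝓘(ℝ, EP)) u₀).symmₗ ℝ u)

theorem formInTrivialization_apply (hκ : ∀ u, Function.Bijective (κ u)) (u₀ u : P) (v : EP) :
    formInTrivialization κ hκ u₀ u v = parallelField κ hκ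
      (κ u ((trivializationAt EP (TangentSpace 𝓘(ℝ, EP)) u₀).symmₗ ℝ u v)) u₀ :=
  rfl

theorem contMDiffAt_formInTrivialization (hsmooth : IsSmoothForm κ)
    (hκ : ∀ u, Function.Bijective (κ u)) (u₀ : P) :
    ContMDiffAt 𝓘(ℝ, EP) 𝓘(ℝ, EP →L[ℝ] EP) ∞ (formInTrivialization κ hκ u₀) u₀ := by
  refine contMDiffAt_clm_of_forall_apply fun v => contMDiffAt_of_forall_dual fun ℓ => ?_
  exact (hsmooth (ℓ ∘ₗ (LinearEquiv.ofBijective (κ u₀) (hκ u₀)).symm.toLinearMap)).contMDiffAt.comp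
    u₀ (contMDiffAt_trivializationAt_symmₗ (mem_baseSet_trivializationAt EP _ u₀) v)

theorem isInvertible_formInTrivialization (hκ : ∀ u, Function.Bijective (κ u)) {u₀ u : P}
    (hu : u ∈ (trivializationAt EP (TangentSpace 𝓘(ℝ, EP)) u₀).baseSet) :
    (formInTrivialization κ hκ u₀ u).IsInvertible := by
  let e := trivializationAt EP (TangentSpace 𝓘(ℝ, EP) (M := P)) u₀
  let A : EP ≃ₗ[ℝ] EP := (e.linearEquivAt ℝ u hu).symm.trans
    ((LinearEquiv.ofBijective (κ u) (hκ u)).trans (LinearEquiv.ofBijective (κ u₀) (hκ u₀)).symm)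
  refine ⟨A.toContinuousLinearEquiv, ContinuousLinearMap.ext fun v => ?_⟩
  rw [formInTrivialization_apply, e.symmₗ_apply hu]
  rfl

theorem formInTrivialization_apply_parallelField (hκ : ∀ u, Function.Bijective (κ u)) {u₀ u : P}
    (hu : u ∈ (trivializationAt EP (TangentSpace 𝓘(ℝ, EP)) u₀).baseSet) (X : W) :
    formInTrivialization κ hκ u₀ u
        (trivializationAt EP (TangentSpace 𝓘(ℝ, EP)) u₀ ⟨u, parallelField κ hκ X u⟩).2 =
      parallelField κ hκ X u₀ := by
  rw [formInTrivialization_apply, Bundle.Trivialization.symmₗ_apply _ hu,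
    Bundle.Trivialization.symm_apply_apply_mk _ hu, apply_parallelField]

theorem contMDiff_parallelField (hsmooth : IsSmoothForm κ) (hκ : ∀ u, Function.Bijective (κ u))
    (X : W) : ContMDiff 𝓘(ℝ, EP) 𝓘(ℝ, EP).tangent ∞
      (fun u => (parallelField κ hκ X u : TangentBundle 𝓘(ℝ, EP) P)) := by
  intro u₀
  let e := trivializationAt EP (TangentSpace 𝓘(ℝ, EP) (M := P)) u₀
  have hu₀ : u₀ ∈ e.baseSet := mem_baseSet_trivializationAt EP _ u₀
  have hinv : ContMDiffAt 𝓘(ℝ, EP) 𝓘(ℝ, EP) ∞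
      (fun u => (formInTrivialization κ hκ u₀ u).inverse (parallelField κ hκ X u₀)) u₀ :=
    ((isInvertible_formInTrivialization hκ hu₀).contDiffAt_map_inverse.contMDiffAt.comp u₀
      (contMDiffAt_formInTrivialization hsmooth hκ u₀)).clm_apply contMDiffAt_const
  refine (Bundle.contMDiffAt_section u₀).2 (hinv.congr_of_eventuallyEq ?_)
  filter_upwards [e.open_baseSet.mem_nhds hu₀] with u hu
  exact ((isInvertible_formInTrivialization hκ hu).inverse_apply_eq.2
    (formInTrivialization_apply_parallelField hκ hu X).symm).symm

end ParallelFields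

section PrincipalBundles

variable {EG : Type*} [NormedAddCommGroup EG] [NormedSpace ℝ EG]
  {G : Type*} [TopologicalSpace G] [ChartedSpace EG G] [Group G]
  {EP : Type*} [NormedAddCommGroup EP] [NormedSpace ℝ EP]
  {P : Type*} [TopologicalSpace P] [ChartedSpace EP P] [MulAction Gᵐᵒᵖ P]

theorem rt_one {G P : Type*} [Group G] [MulAction Gᵐᵒᵖ P] (u : P) : rt (1 : G) u = u := by
  rw [rt, MulOpposite.op_one, one_smul]

theorem contMDiff_rt_right {n : WithTop ℕ∞}
    (hact : ContMDiff (𝓘(ℝ, EP).prod 𝓘(ℝ, EG)) 𝓘(ℝ, EP) n (fun q : P × G => rt q.2 q.1)) (u : P) :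
    ContMDiff 𝓘(ℝ, EG) 𝓘(ℝ, EP) n (fun g : G => rt g u) :=
  hact.comp (contMDiff_const.prodMk contMDiff_id)

variable {EM : Type*} [NormedAddCommGroup EM] [NormedSpace ℝ EM]
  {M : Type*} [TopologicalSpace M] [ChartedSpace EM M] {p : P → M}

namespace IsPrincipalBundle

theorem surjective (hp : IsPrincipalBundle EG G EP EM p) : Function.Surjective p := by
  intro x
  obtain ⟨e, hx, -⟩ := hp.exists_trivialization x
  exact ⟨e.toOpenPartialHomeomorph.symm (x, 1), e.proj_symm_apply' hx⟩

theorem finrank_eq [FiniteDimensional ℝ EG] [FiniteDimensional ℝ EM]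
    (hp : IsPrincipalBundle EG G EP EM p) (u : P) :
    Module.finrank ℝ EP = Module.finrank ℝ EM + Module.finrank ℝ EG := by
  obtain ⟨e, hx, he, he_symm, -⟩ := hp.exists_trivialization (p u)
  have he_diff : e.toOpenPartialHomeomorph.MDifferentiable 𝓘(ℝ, EP) (𝓘(ℝ, EM).prod 𝓘(ℝ, EG)) :=
    ⟨he.mdifferentiableOn (by simp), he_symm.mdifferentiableOn (by simp)⟩
  let A : EP ≃L[ℝ] EM × EG := he_diff.mfderiv (e.mem_source.2 hx)
  rw [A.toLinearEquiv.finrank_eq, Module.finrank_prod]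

theorem fundField_mem_vertical (hp : IsPrincipalBundle EG G EP EM p) (X : Lie EG G) (u : P) :
    fundField X u ∈ vertical EP EM p u := by
  have hcomp := mfderiv_comp_apply_of_eq (1 : G) (hp.contMDiff_proj.mdifferentiableAt (by simp))
    ((contMDiff_rt_right hp.contMDiff_action u).mdifferentiableAt (by simp)) (rt_one u) X
  have hconst : p ∘ (fun g : G => rt g u) = fun _ => p u := funext fun g => hp.proj_rt u g
  rw [hconst, mfderiv_const] at hcomp
  exact hcomp.symm

variable [LieGroup 𝓘(ℝ, EG) ∞ G]

theorem exists_rt_section_eventuallyEq (hp : IsPrincipalBundle EG G EP EM p) (u : P) :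
    ∃ (σ : M → P) (τ : P → G), MDifferentiableAt 𝓘(ℝ, EM) 𝓘(ℝ, EP) σ (p u) ∧
      MDifferentiableAt 𝓘(ℝ, EP) 𝓘(ℝ, EG) τ u ∧ σ (p u) = u ∧ τ u = 1 ∧
      ∀ᶠ v in 𝓝 u, rt (τ v) (σ (p v)) = v := by
  obtain ⟨e, hx, he, he_symm, hequi⟩ := hp.exists_trivialization (p u)
  have hu : u ∈ e.source := e.mem_source.2 hx
  have heu : (p u, (e u).2) = e u := Prod.ext (e.coe_fst hu).symm rfl
  have htarget : (p u, (e u).2) ∈ e.target := e.mem_target.2 hx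
  refine ⟨fun x => e.toOpenPartialHomeomorph.symm (x, (e u).2), fun v => (e u).2⁻¹ * (e v).2,
    ?_, ?_, ?_, inv_mul_cancel _, ?_⟩
  · exact ((he_symm.contMDiffAt (e.open_target.mem_nhds htarget)).comp (p u)
      (contMDiffAt_id.prodMk contMDiffAt_const)).mdifferentiableAt (by simp)
  · have he_snd : ContMDiffAt 𝓘(ℝ, EP) 𝓘(ℝ, EG) ∞ (fun v => (e v).2) u :=
      contMDiffAt_snd.comp u (he.contMDiffAt (e.open_source.mem_nhds hu))
    exact (contMDiffAt_const.mul he_snd).mdifferentiableAt (by simp)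
  · exact (congrArg _ heu).trans (e.left_inv hu)
  · filter_upwards [e.open_source.mem_nhds hu] with v hv
    have hpv : p v ∈ e.baseSet := e.mem_source.1 hv
    have hproj := e.proj_symm_apply' (x := (e u).2) hpv
    refine e.injOn (e.mem_source.2 ?_) hv ((hequi _ (e.mem_source.2 ?_) _).trans ?_)
    · rwa [hp.proj_rt, hproj]
    · rwa [hproj]
    · rw [e.apply_symm_apply' hpv, mul_inv_cancel_left]
      exact Prod.ext (e.coe_fst hv).symm rfl

theorem exists_fundField_eq (hp : IsPrincipalBundle EG G EP EM p) {u : P}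
    {ξ : TangentSpace 𝓘(ℝ, EP) u} (hξ : ξ ∈ vertical EP EM p u) :
    ∃ X : Lie EG G, fundField X u = ξ := by
  obtain ⟨σ, τ, hσ, hτ, hσu, hτu, hστ⟩ := hp.exists_rt_section_eventuallyEq u
  let ρ : P × G → P := fun q => rt q.2 q.1
  have hρ : MDifferentiableAt (𝓘(ℝ, EP).prod 𝓘(ℝ, EG)) 𝓘(ℝ, EP) ρ (u, 1) :=
    hp.contMDiff_action.mdifferentiableAt (by simp)
  have hp_diff : MDifferentiableAt 𝓘(ℝ, EP) 𝓘(ℝ, EM) p u :=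
    hp.contMDiff_proj.mdifferentiableAt (by simp)
  have hσp : MDifferentiableAt 𝓘(ℝ, EP) 𝓘(ℝ, EP) (σ ∘ p) u := hσ.comp u hp_diff
  have hσp_ξ : mfderiv 𝓘(ℝ, EP) 𝓘(ℝ, EP) (σ ∘ p) u ξ = 0 :=
    (mfderiv_comp_apply u hσ hp_diff ξ).trans <|
      (congrArg (mfderiv 𝓘(ℝ, EM) 𝓘(ℝ, EP) σ (p u)) hξ).trans (map_zero _)
  have hρ_id : ρ ∘ (fun v => ((σ ∘ p) v, τ v)) =ᶠ[𝓝 u] id := hστ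
  let X : EG := mfderiv 𝓘(ℝ, EP) 𝓘(ℝ, EG) τ u ξ
  have hchain : (mfderiv (𝓘(ℝ, EP).prod 𝓘(ℝ, EG)) 𝓘(ℝ, EP) ρ (u, 1) ((0 : EP), X) : EP) = ξ := by
    have hcomp := mfderiv_comp_apply_of_eq u hρ (hσp.prodMk hτ) (Prod.ext hσu hτu) ξ
    rw [hρ_id.mfderiv_eq, mfderiv_id, mfderiv_prodMk hσp hτ] at hcomp
    refine (congrArg (fun η : EP => mfderiv (𝓘(ℝ, EP).prod 𝓘(ℝ, EG)) 𝓘(ℝ, EP) ρ (u, 1) (η, X))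
      ?_).trans hcomp.symm
    exact hσp_ξ.symm
  have hsplit : (mfderiv (𝓘(ℝ, EP).prod 𝓘(ℝ, EG)) 𝓘(ℝ, EP) ρ (u, 1) ((0 : EP), X) : EP) =
      fundField X u :=
    (mfderiv_prod_eq_add_apply hρ).trans <|
      (congrArg (· + fundField X u) (map_zero _)).trans (zero_add _)
  exact ⟨X, hsplit.symm.trans hchain⟩

theorem mem_vertical_iff (hp : IsPrincipalBundle EG G EP EM p) {u : P}
    {ξ : TangentSpace 𝓘(ℝ, EP) u} :
    ξ ∈ vertical EP EM p u ↔ ∃ X : Lie EG G, fundField X u = ξ := by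
  refine ⟨hp.exists_fundField_eq, ?_⟩
  rintro ⟨X, rfl⟩
  exact hp.fundField_mem_vertical X u

end IsPrincipalBundle

end PrincipalBundles

section ReductiveDecomposition

variable {EG : Type*} [NormedAddCommGroup EG] [NormedSpace ℝ EG]
  {G : Type*} [TopologicalSpace G] [ChartedSpace EG G] [Group G]
  {EH : Type*} [NormedAddCommGroup EH] [NormedSpace ℝ EH]
  {H : Type*} [TopologicalSpace H] [ChartedSpace EH H] [Group H]
  {ι : G →* H} {V : Submodule ℝ (Lie EH H)}

theorem prV_coe (hV : IsReductive EG ι V) (v : V) : prV hV (v : Lie EH H) = v :=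
  Submodule.projectionOnto_apply_left _ v

theorem prV_dHom (hV : IsReductive EG ι V) (X : Lie EG G) : prV hV (dHom EG EH ι X) = 0 :=
  Submodule.projectionOnto_apply_of_mem_right _ ⟨X, rfl⟩

theorem ker_prV (hV : IsReductive EG ι V) : LinearMap.ker (prV hV) = subAlg EG EH ι :=
  Submodule.ker_projectionOnto _

theorem prG_coe (hι : IsLieSubgroup EG EH ι) (hV : IsReductive EG ι V) (v : V) :
    prG hι hV (v : Lie EH H) = 0 :=
  (LinearEquiv.symm_apply_eq _).2 <|
    (Submodule.projectionOnto_apply_of_mem_right _ v.2).trans (map_zero _).symm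

theorem prG_dHom (hι : IsLieSubgroup EG EH ι) (hV : IsReductive EG ι V) (X : Lie EG G) :
    prG hι hV (dHom EG EH ι X) = X :=
  (LinearEquiv.symm_apply_eq _).2 <| Submodule.projectionOnto_apply_left _
    (LinearEquiv.ofInjective (dHom EG EH ι) hι.injective_dHom X)

theorem exists_coe_add_dHom_eq (hV : IsReductive EG ι V) (w : Lie EH H) :
    ∃ (v : V) (X : Lie EG G), (v : Lie EH H) + dHom EG EH ι X = w := by
  have hw : w ∈ V ⊔ subAlg EG EH ι := hV.isCompl.sup_eq_top ▸ Submodule.mem_top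
  obtain ⟨v, hv, _, ⟨X, rfl⟩, rfl⟩ := Submodule.mem_sup.1 hw
  exact ⟨⟨v, hv⟩, X, rfl⟩

theorem finrank_eq_finrank_add [FiniteDimensional ℝ EH] (hι : IsLieSubgroup EG EH ι)
    (hV : IsReductive EG ι V) :
    Module.finrank ℝ EH = Module.finrank ℝ V + Module.finrank ℝ EG := by
  have : FiniteDimensional ℝ (Lie EH H) := inferInstanceAs (FiniteDimensional ℝ EH)
  have hsubAlg : Module.finrank ℝ (subAlg EG EH ι) = Module.finrank ℝ EG :=
    LinearMap.finrank_range_of_inj hι.injective_dHom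
  rw [← hsubAlg]
  exact (Submodule.finrank_add_eq_of_isCompl hV.isCompl).symm

variable [LieGroup 𝓘(ℝ, EH) ∞ H]

theorem contMDiff_adRep_apply [FiniteDimensional ℝ EH]
    (hι : ContMDiff 𝓘(ℝ, EG) 𝓘(ℝ, EH) ∞ ι) (hV : IsReductive EG ι V) (v : V)
    (ℓ : Module.Dual ℝ V) : ContMDiff 𝓘(ℝ, EG) 𝓘(ℝ) ∞ (fun g : G => ℓ (adRep hV g v)) := by
  let L : EH →ₗ[ℝ] ℝ := ℓ ∘ₗ prV hV
  refine (L.toContinuousLinearMap.contMDiff.comp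
    ((contMDiff_adOrbit (v : Lie EH H)).comp hι)).congr fun g => ?_
  exact congrArg ℓ (prV_coe hV (adRep hV g v)).symm

theorem prV_Ad [LieGroup 𝓘(ℝ, EG) ∞ G] (hι : ContMDiff 𝓘(ℝ, EG) 𝓘(ℝ, EH) ∞ ι)
    (hV : IsReductive EG ι V) (g : G) (w : Lie EH H) :
    prV hV (Ad (ι g) w) = adRep hV g (prV hV w) := by
  obtain ⟨v, X, rfl⟩ := exists_coe_add_dHom_eq hV w
  rw [map_add, Ad_dHom hι, map_add, map_add, prV_dHom, prV_dHom, prV_coe, add_zero, add_zero]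
  exact prV_coe hV (adRep hV g v)

theorem prG_Ad [LieGroup 𝓘(ℝ, EG) ∞ G] (hι : IsLieSubgroup EG EH ι) (hV : IsReductive EG ι V)
    (g : G) (w : Lie EH H) : prG hι hV (Ad (ι g) w) = Ad g (prG hι hV w) := by
  obtain ⟨v, X, rfl⟩ := exists_coe_add_dHom_eq hV w
  have hv : prG hι hV (Ad (ι g) v) = 0 := prG_coe hι hV (adRep hV g v)
  rw [map_add, Ad_dHom hι.contMDiff, map_add, map_add, hv, prG_coe, prG_dHom, prG_dHom, zero_add,
    zero_add]

end ReductiveDecomposition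

section CartanConnections

variable {EG : Type*} [NormedAddCommGroup EG] [NormedSpace ℝ EG]
  {EH : Type*} [NormedAddCommGroup EH] [NormedSpace ℝ EH]
  {H : Type*} [TopologicalSpace H] [ChartedSpace EH H] [Group H] [LieGroup 𝓘(ℝ, EH) ∞ H]
  {EP : Type*} [NormedAddCommGroup EP] [NormedSpace ℝ EP]
  {P : Type*} [TopologicalSpace P] [ChartedSpace EP P]

theorem parallelField_rt {G : Type*} [Group G] [MulAction Gᵐᵒᵖ P] {ι : G →* H}
    {κ : Form EP P (Lie EH H)} (hκ : ∀ u, Function.Bijective (κ u))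
    (hequi : ∀ (g : G) (u : P) (ξ : TangentSpace 𝓘(ℝ, EP) u),
      κ (rt g u) (tangentRt g u ξ) = Ad (ι g⁻¹) (κ u ξ)) (X : Lie EH H) (g : G) (u : P) :
    parallelField κ hκ X (rt g u) = tangentRt g u (parallelField κ hκ (Ad (ι g) X) u) := by
  rw [parallelField_eq_iff, hequi, apply_parallelField, ← Ad_mul_apply, ← map_mul, inv_mul_cancel,
    map_one, Ad_one_apply]

variable {G : Type*} [TopologicalSpace G] [ChartedSpace EG G] [Group G] [LieGroup 𝓘(ℝ, EG) ∞ G]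
  [MulAction Gᵐᵒᵖ P] {ι : G →* H}
  [FiniteDimensional ℝ EH] [FiniteDimensional ℝ EP] [IsManifold 𝓘(ℝ, EP) ∞ P]

theorem mlieBracket_parallelField {κ : Form EP P (Lie EH H)}
    (hι : ContMDiff 𝓘(ℝ, EG) 𝓘(ℝ, EH) ∞ ι)
    (hact : ContMDiff (𝓘(ℝ, EP).prod 𝓘(ℝ, EG)) 𝓘(ℝ, EP) ∞ (fun q : P × G => rt q.2 q.1))
    (hsmooth : IsSmoothForm κ) (hκ : ∀ u, Function.Bijective (κ u))
    (hvert : ∀ (u : P) (X : Lie EG G), κ u (fundField X u) = dHom EG EH ι X)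
    (hequi : ∀ (g : G) (u : P) (ξ : TangentSpace 𝓘(ℝ, EP) u),
      κ (rt g u) (tangentRt g u ξ) = Ad (ι g⁻¹) (κ u ξ))
    (X : Lie EH H) (Y : Lie EG G) (u : P) :
    mlieBracket 𝓘(ℝ, EP) (parallelField κ hκ (dHom EG EH ι Y)) (parallelField κ hκ X) u =
      parallelField κ hκ ⁅dHom EG EH ι Y, X⁆ u := by
  have : IsManifold 𝓘(ℝ, EG) ∞ G := ContMDiffMul.toIsManifold
  have : CompleteSpace EP := FiniteDimensional.complete ℝ EP
  have : CompleteSpace EH := FiniteDimensional.complete ℝ EH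
  have hfund (v : P) : parallelField κ hκ (dHom EG EH ι Y) v = fundField Y v :=
    (parallelField_eq_iff hκ).2 (hvert v Y).symm
  let L : EH →ₗ[ℝ] EP := (LinearEquiv.ofBijective (κ u) (hκ u)).symm.toLinearMap
  have horbit : MDifferentiableAt 𝓘(ℝ, EG) 𝓘(ℝ, EH) (adOrbit X ∘ ι) 1 :=
    ((contMDiff_adOrbit X).comp hι).mdifferentiableAt (by simp)
  have hL : MDifferentiable 𝓘(ℝ, EH) 𝓘(ℝ, EP) L.toContinuousLinearMap :=
    L.toContinuousLinearMap.mdifferentiable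
  have hbracket := mlieBracket_eq_mfderiv_of_transported (ρ := fun q : P × G => rt q.2 q.1)
    (hact.of_le ENat.LEInfty.out) rt_one (fun v => by rw [rt_one]; exact hfund v)
    ((contMDiff_parallelField hsmooth hκ X).mdifferentiableAt (by simp))
    (hL.mdifferentiableAt.comp 1 horbit) fun g => parallelField_rt hκ hequi X g u
  rw [hbracket, lie_dHom_eq_mfderiv_adOrbit hι,
    mfderiv_comp_apply 1 hL.mdifferentiableAt horbit, mfderiv_eq_fderiv,
    ContinuousLinearMap.fderiv]
  rfl

theorem IsPrincipalCartanConnection.of_equivariant {κ : Form EP P (Lie EH H)}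
    (hι : ContMDiff 𝓘(ℝ, EG) 𝓘(ℝ, EH) ∞ ι)
    (hact : ContMDiff (𝓘(ℝ, EP).prod 𝓘(ℝ, EG)) 𝓘(ℝ, EP) ∞ (fun q : P × G => rt q.2 q.1))
    (hsmooth : IsSmoothForm κ) (hκ : ∀ u, Function.Bijective (κ u))
    (hvert : ∀ (u : P) (X : Lie EG G), κ u (fundField X u) = dHom EG EH ι X)
    (hequi : ∀ (g : G) (u : P) (ξ : TangentSpace 𝓘(ℝ, EP) u),
      κ (rt g u) (tangentRt g u ξ) = Ad (ι g⁻¹) (κ u ξ)) :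
    IsPrincipalCartanConnection EG ι κ where
  smooth := hsmooth
  bijective := hκ
  vertical_eq := hvert
  equivariant := hequi
  bracket := by
    rintro X _ ⟨Y, rfl⟩ u
    have hskew : ⁅X, dHom EG EH ι Y⁆ = -⁅dHom EG EH ι Y, X⁆ := mlieBracket_swap_apply
    rw [mlieBracket_swap_apply, mlieBracket_parallelField hι hact hsmooth hκ hvert hequi, hskew]
    exact (map_neg (LinearEquiv.ofBijective (κ u) (hκ u)).symm _).symm

end CartanConnections

section Components

variable {EG : Type*} [NormedAddCommGroup EG] [NormedSpace ℝ EG]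
  {G : Type*} [TopologicalSpace G] [ChartedSpace EG G] [Group G]
  {EH : Type*} [NormedAddCommGroup EH] [NormedSpace ℝ EH]
  {H : Type*} [TopologicalSpace H] [ChartedSpace EH H] [Group H]
  {EM : Type*} [NormedAddCommGroup EM] [NormedSpace ℝ EM]
  {M : Type*} [TopologicalSpace M] [ChartedSpace EM M]
  {EP : Type*} [NormedAddCommGroup EP] [NormedSpace ℝ EP]
  {P : Type*} [TopologicalSpace P] [ChartedSpace EP P] [IsManifold 𝓘(ℝ, EP) ∞ P]
  [MulAction Gᵐᵒᵖ P] {p : P → M} {ι : G →* H} {V : Submodule ℝ (Lie EH H)}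

theorem IsGStructure.apply_fundField {W : Type*} [AddCommGroup W] [Module ℝ W]
    {ρ : Representation ℝ G W} {θ : Form EP P W} (hθ : IsGStructure EG EM ρ p θ) (u : P)
    (X : Lie EG G) :
    θ u (fundField X u) = 0 := by
  rw [← LinearMap.mem_ker, hθ.displacement.ker_eq]
  exact hθ.principal.fundField_mem_vertical X u

namespace IsPrincipalCartanConnection

variable {κ : Form EP P (Lie EH H)}

theorem finrank_base_eq [FiniteDimensional ℝ EG] [FiniteDimensional ℝ EH] [FiniteDimensional ℝ EM]
    (hκ : IsPrincipalCartanConnection EG ι κ) (hp : IsPrincipalBundle EG G EP EM p)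
    (hι : IsLieSubgroup EG EH ι) (hV : IsReductive EG ι V) (u : P) :
    Module.finrank ℝ EM = Module.finrank ℝ V := by
  have hPH : Module.finrank ℝ EP = Module.finrank ℝ EH :=
    (LinearEquiv.ofBijective (κ u) (hκ.bijective u)).finrank_eq
  have hP := hp.finrank_eq u
  have hH := finrank_eq_finrank_add hι hV
  omega

variable [LieGroup 𝓘(ℝ, EG) ∞ G]

theorem apply_mem_subAlg_iff (hκ : IsPrincipalCartanConnection EG ι κ)
    (hp : IsPrincipalBundle EG G EP EM p) {u : P} {ξ : TangentSpace 𝓘(ℝ, EP) u} :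
    κ u ξ ∈ subAlg EG EH ι ↔ ξ ∈ vertical EP EM p u := by
  rw [hp.mem_vertical_iff]
  exact exists_congr fun X => by rw [← hκ.vertical_eq u X, (hκ.bijective u).1.eq_iff]

variable [LieGroup 𝓘(ℝ, EH) ∞ H]

theorem isConnectionForm_prG (hκ : IsPrincipalCartanConnection EG ι κ)
    (hι : IsLieSubgroup EG EH ι) (hV : IsReductive EG ι V) :
    IsConnectionForm (fun u => prG hι hV ∘ₗ κ u) where
  smooth ℓ := hκ.smooth (ℓ ∘ₗ prG hι hV)
  vertical_eq u X := by rw [LinearMap.comp_apply, hκ.vertical_eq, prG_dHom]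
  equivariant g u ξ := by
    rw [LinearMap.comp_apply, hκ.equivariant, prG_Ad hι hV, LinearMap.comp_apply]

theorem isDisplacementForm_prV (hκ : IsPrincipalCartanConnection EG ι κ)
    (hp : IsPrincipalBundle EG G EP EM p) (hι : ContMDiff 𝓘(ℝ, EG) 𝓘(ℝ, EH) ∞ ι)
    (hV : IsReductive EG ι V) :
    IsDisplacementForm EM (adRep hV) p (fun u => prV hV ∘ₗ κ u) where
  smooth ℓ := hκ.smooth (ℓ ∘ₗ prV hV)
  equivariant g u ξ := by
    rw [LinearMap.comp_apply, hκ.equivariant, prV_Ad hι, LinearMap.comp_apply]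
  ker_eq u := by
    ext ξ
    rw [LinearMap.ker_comp, ker_prV, Submodule.mem_comap, hκ.apply_mem_subAlg_iff hp]

theorem isGStructure_prV [FiniteDimensional ℝ EG] [FiniteDimensional ℝ EH]
    [FiniteDimensional ℝ EM] (hκ : IsPrincipalCartanConnection EG ι κ)
    (hp : IsPrincipalBundle EG G EP EM p) (hι : IsLieSubgroup EG EH ι) (hV : IsReductive EG ι V)
    (hfaithful : Function.Injective (adRep hV)) :
    IsGStructure EG EM (adRep hV) p (fun u => prV hV ∘ₗ κ u) where
  faithful := hfaithful
  smooth_rep := contMDiff_adRep_apply hι.contMDiff hV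
  principal := hp
  dim_eq x := by
    obtain ⟨u, -⟩ := hp.surjective x
    exact hκ.finrank_base_eq (EM := EM) hp hι hV u
  displacement := hκ.isDisplacementForm_prV hp hι.contMDiff hV

end IsPrincipalCartanConnection

variable [LieGroup 𝓘(ℝ, EG) ∞ G]

theorem IsConnectionForm.eq_zero_of_mem_vertical {om : Form EP P (Lie EG G)}
    (hom : IsConnectionForm om) (hp : IsPrincipalBundle EG G EP EM p) {u : P}
    {ξ : TangentSpace 𝓘(ℝ, EP) u} (hξ : ξ ∈ vertical EP EM p u) (hom_ξ : om u ξ = 0) : ξ = 0 := by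
  obtain ⟨X, rfl⟩ := hp.mem_vertical_iff.1 hξ
  obtain rfl : X = 0 := by rw [← hom.vertical_eq u X, hom_ξ]
  exact map_zero (mfderiv 𝓘(ℝ, EG) 𝓘(ℝ, EP) (fun g : G => rt g u) 1)

namespace IsGStructure

variable {ρ : Representation ℝ G V} {θ : Form EP P V} {om : Form EP P (Lie EG G)}

theorem injective_add (hθ : IsGStructure EG EM ρ p θ) (hom : IsConnectionForm om)
    (hι : IsLieSubgroup EG EH ι) (hV : IsReductive EG ι V) (u : P) :
    Function.Injective (V.subtype ∘ₗ θ u + dHom EG EH ι ∘ₗ om u) := by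
  rw [← LinearMap.ker_eq_bot, LinearMap.ker_eq_bot']
  intro ξ hξ
  have hsum : (θ u ξ : Lie EH H) + dHom EG EH ι (om u ξ) = 0 := hξ
  have hθ_ξ : θ u ξ = 0 := by
    simpa only [map_add, prV_coe, prV_dHom, add_zero, map_zero] using congrArg (prV hV) hsum
  have hom_ξ : om u ξ = 0 := by
    simpa only [map_add, prG_coe, prG_dHom, zero_add, map_zero] using congrArg (prG hι hV) hsum
  rw [← LinearMap.mem_ker, hθ.displacement.ker_eq] at hθ_ξ
  exact hom.eq_zero_of_mem_vertical hθ.principal hθ_ξ hom_ξ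

variable [FiniteDimensional ℝ EG] [FiniteDimensional ℝ EH] [FiniteDimensional ℝ EM]
  [FiniteDimensional ℝ EP]

theorem bijective_add (hθ : IsGStructure EG EM ρ p θ) (hom : IsConnectionForm om)
    (hι : IsLieSubgroup EG EH ι) (hV : IsReductive EG ι V) (u : P) :
    Function.Bijective (V.subtype ∘ₗ θ u + dHom EG EH ι ∘ₗ om u) := by
  have hinj := hθ.injective_add hom hι hV u
  have : FiniteDimensional ℝ (Lie EH H) := inferInstanceAs (FiniteDimensional ℝ EH)
  have : FiniteDimensional ℝ (TangentSpace 𝓘(ℝ, EP) u) := inferInstanceAs (FiniteDimensional ℝ EP)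
  have hfinrank : Module.finrank ℝ EP = Module.finrank ℝ EH := by
    have hM : Module.finrank ℝ EM = Module.finrank ℝ V := hθ.dim_eq (p u)
    rw [hθ.principal.finrank_eq u, finrank_eq_finrank_add hι hV, hM]
  exact ⟨hinj, (LinearMap.injective_iff_surjective_of_finrank_eq_finrank hfinrank).1 hinj⟩

theorem isPrincipalCartanConnection_add [LieGroup 𝓘(ℝ, EH) ∞ H] {hV : IsReductive EG ι V}
    (hθ : IsGStructure EG EM (adRep hV) p θ) (hom : IsConnectionForm om)
    (hι : IsLieSubgroup EG EH ι) :
    IsPrincipalCartanConnection EG ι (fun u => V.subtype ∘ₗ θ u + dHom EG EH ι ∘ₗ om u) := by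
  refine .of_equivariant hι.contMDiff hθ.principal.contMDiff_action (fun ℓ => ?_)
    (hθ.bijective_add hom hι hV) (fun u X => ?_) fun g u ξ => ?_
  · exact ((hθ.displacement.smooth (ℓ ∘ₗ V.subtype)).add
      (hom.smooth (ℓ ∘ₗ dHom EG EH ι))).congr fun ξ => map_add ℓ _ _
  · simp only [LinearMap.add_apply, LinearMap.comp_apply, hθ.apply_fundField, hom.vertical_eq,
      map_zero, zero_add]
  · simp only [LinearMap.add_apply, LinearMap.comp_apply, hθ.displacement.equivariant,
      hom.equivariant, map_add, Ad_dHom hι.contMDiff]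
    rfl

end IsGStructure

end Components

end CartanConn

open CartanConn in
theorem proposition2p4
    {EG : Type*} [NormedAddCommGroup EG] [NormedSpace ℝ EG] [FiniteDimensional ℝ EG]
    {G : Type*} [TopologicalSpace G] [ChartedSpace EG G] [Group G] [LieGroup 𝓘(ℝ, EG) ∞ G]
    {EH : Type*} [NormedAddCommGroup EH] [NormedSpace ℝ EH] [FiniteDimensional ℝ EH]
    {H : Type*} [TopologicalSpace H] [ChartedSpace EH H] [Group H] [LieGroup 𝓘(ℝ, EH) ∞ H]
    {EM : Type*} [NormedAddCommGroup EM] [NormedSpace ℝ EM] [FiniteDimensional ℝ EM]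
    {M : Type*} [TopologicalSpace M] [ChartedSpace EM M] [IsManifold 𝓘(ℝ, EM) ∞ M]
    {EP : Type*} [NormedAddCommGroup EP] [NormedSpace ℝ EP] [FiniteDimensional ℝ EP]
    {P : Type*} [TopologicalSpace P] [ChartedSpace EP P] [IsManifold 𝓘(ℝ, EP) ∞ P]
    [MulAction Gᵐᵒᵖ P]
    (p : P → M) (hp : IsPrincipalBundle EG G EP EM p)
    (ι : G →* H) (hι : IsLieSubgroup EG EH ι)
    (V : Submodule ℝ (Lie EH H)) (hV : IsReductive EG ι V)
    (hfaithful : Function.Injective (adRep hV)) :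
    (∀ κ : Form EP P (Lie EH H), IsPrincipalCartanConnection EG ι κ →
      IsGStructure EG EM (adRep hV) p (fun u => prV hV ∘ₗ κ u) ∧
      IsConnectionForm (fun u => prG hι hV ∘ₗ κ u)) ∧
    (∀ (θ : Form EP P V) (om : Form EP P (Lie EG G)),
      IsGStructure EG EM (adRep hV) p θ → IsConnectionForm om →
      IsPrincipalCartanConnection EG ι
        (fun u => V.subtype ∘ₗ θ u + dHom EG EH ι ∘ₗ om u)) := by
  refine ⟨fun κ hκ => ⟨?_, ?_⟩, fun θ om hθ hom => ?_⟩
  · exact hκ.isGStructure_prV hp hι hV hfaithful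
  · exact hκ.isConnectionForm_prG hι hV
  · exact hθ.isPrincipalCartanConnection_add hom hι
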